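/- The brushing game on a finite simple graph $G$ is played by two players, Min and Max. Initially every vertex is dirty and there are no brushes on the vertices. The players alternate turns, Min moving first; on each turn the player adds one brush to a dirty vertex of his or her choice. Whenever a dirty vertex has at least as many brushes as it has dirty neighbors, it fires: it sends one brush to each of its dirty neighbors and becomes clean. After each turn vertices fire until no dirty vertex is ready to fire (the order of the firings affects neither the resulting set of dirty vertices nor the brushes on them). The game ends when all vertices are clean. Min wants to minimize, and Max to maximize, the total number of turns, and the game brush number $b_g(G)$ is the number of turns when both players play optimally. Theorem. For the complete graph $K_n$ on $n$ vertices, $$b_g(K_n) = (1+o(1))\,\frac{n^2}{e} \qquad (n\to\infty).$$ -/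

import Mathlib

open Filter Asymptotics

/-- A position of the brushing process: the set of vertices that are still dirty, and the number of
brushes currently lying on each vertex (brushes on clean vertices play no further role). -/
structure BrushState (V : Type*) where
  dirty : Finset V
  brushes : V → ℕ

namespace BrushState

variable {V : Type*} [DecidableEq V] (G : SimpleGraph V) [DecidableRel G.Adj]

/-- The dirty neighbours of `v`. -/
def dirtyNbrs (s : BrushState V) (v : V) : Finset V :=
  s.dirty.filter (fun u => G.Adj v u)

/-- A dirty vertex is ready to fire if it has at least as many brushes as dirty neighbours. -/
def Ready (s : BrushState V) (v : V) : Prop :=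
  v ∈ s.dirty ∧ (s.dirtyNbrs G v).card ≤ s.brushes v

/-- Firing `v`: it becomes clean and sends one brush to each of its dirty neighbours. -/
def fire (s : BrushState V) (v : V) : BrushState V where
  dirty := s.dirty.erase v
  brushes := fun u =>
    if u = v then s.brushes v - (s.dirtyNbrs G v).card
    else if u ∈ s.dirtyNbrs G v then s.brushes u + 1
    else s.brushes u

/-- Fire ready vertices, one at a time, until no vertex is ready. The choice of the next vertex is
arbitrary; by `firingSequence_eq_stabilize` it affects neither the resulting dirty set nor the
brushes on the dirty vertices. -/
noncomputable def stabilize (s : BrushState V) : BrushState V :=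
  open Classical in
  if h : ∃ v, s.Ready G v then (s.fire G h.choose).stabilize else s
termination_by s.dirty.card
decreasing_by exact Finset.card_erase_lt_of_mem h.choose_spec.1

/-- Put one more brush on `v`. -/
def place (s : BrushState V) (v : V) : BrushState V where
  dirty := s.dirty
  brushes := Function.update s.brushes v (s.brushes v + 1)

/-- One turn: the player puts a brush on `v`, and then vertices fire until the position is stable. -/
noncomputable def turn (s : BrushState V) (v : V) : BrushState V :=
  (s.place v).stabilize G

/-- `t` is obtained from `s` by firing one ready vertex. -/
def FiresTo (s t : BrushState V) : Prop :=
  ∃ v, s.Ready G v ∧ t = s.fire G v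

theorem fire_dirtyNbrs_card {s : BrushState V} {v u : V} (hv : v ∈ s.dirty)
    (hu : u ∈ (s.fire G v).dirty) :
    (s.fire G v).brushes u + ((s.fire G v).dirtyNbrs G u).card
      = s.brushes u + (s.dirtyNbrs G u).card := by
  have huv : u ≠ v := (Finset.mem_erase.1 hu).1
  have hus : u ∈ s.dirty := (Finset.mem_erase.1 hu).2
  have hd : (s.fire G v).dirtyNbrs G u = (s.dirtyNbrs G u).erase v := by
    simp [dirtyNbrs, fire, Finset.filter_erase]
  rw [hd]
  by_cases hadj : G.Adj v u
  · have h1 : v ∈ s.dirtyNbrs G u := by simp [dirtyNbrs, hv, hadj.symm]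
    have h2 : u ∈ s.dirtyNbrs G v := by simp [dirtyNbrs, hus, hadj]
    have h3 := Finset.card_erase_add_one h1
    simp only [fire, if_neg huv, if_pos h2]
    omega
  · have h1 : v ∉ s.dirtyNbrs G u := by simp [dirtyNbrs, G.adj_comm, hadj]
    have h2 : u ∉ s.dirtyNbrs G v := by simp [dirtyNbrs, hadj]
    rw [Finset.erase_eq_of_notMem h1]
    simp only [fire, if_neg huv, if_neg h2]

theorem firingSequence_invariant {s t : BrushState V}
    (h : Relation.ReflTransGen (FiresTo G) s t) :
    t.dirty ⊆ s.dirty ∧ ∀ u ∈ t.dirty,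
      t.brushes u + (t.dirtyNbrs G u).card = s.brushes u + (s.dirtyNbrs G u).card := by
  induction h with
  | refl => exact ⟨subset_rfl, fun _ _ => rfl⟩
  | tail _ hbc ih =>
    obtain ⟨v, hv, rfl⟩ := hbc
    refine ⟨(Finset.erase_subset _ _).trans ih.1, fun u hu => ?_⟩
    rw [fire_dirtyNbrs_card G hv.1 hu, ih.2 u (Finset.mem_of_mem_erase hu)]

theorem firingSequence_subset {s t t' : BrushState V}
    (h : Relation.ReflTransGen (FiresTo G) s t) (h' : Relation.ReflTransGen (FiresTo G) s t')
    (hstable : ∀ v, ¬ t'.Ready G v) : t'.dirty ⊆ t.dirty := by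
  induction h with
  | refl => exact (firingSequence_invariant G h').1
  | @tail b c hb hbc ih =>
    obtain ⟨v, hv, rfl⟩ := hbc
    refine Finset.subset_erase.2 ⟨ih, fun hv' => hstable v ⟨hv', ?_⟩⟩
    have h1 := (firingSequence_invariant G h').2 v hv'
    have h2 := (firingSequence_invariant G hb).2 v hv.1
    have h3 : (t'.dirtyNbrs G v).card ≤ (b.dirtyNbrs G v).card :=
      Finset.card_le_card (Finset.filter_subset_filter _ ih)
    have h4 := hv.2
    omega

theorem stabilize_spec (s : BrushState V) :
    Relation.ReflTransGen (FiresTo G) s (s.stabilize G) ∧ ∀ v, ¬ (s.stabilize G).Ready G v := by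
  induction hn : s.dirty.card using Nat.strong_induction_on generalizing s with
  | _ n ih =>
    rw [stabilize]
    split_ifs with h
    · have hlt : (s.fire G h.choose).dirty.card < n :=
        hn ▸ Finset.card_erase_lt_of_mem h.choose_spec.1
      obtain ⟨h1, h2⟩ := ih _ hlt _ rfl
      exact ⟨.head ⟨_, h.choose_spec, rfl⟩ h1, h2⟩
    · exact ⟨.refl, fun v hv => h ⟨v, hv⟩⟩

/-- The order in which vertices fire is irrelevant: every maximal sequence of firings ends with the
same dirty vertices, carrying the same numbers of brushes, as `stabilize`. -/
theorem firingSequence_eq_stabilize {s t : BrushState V}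
    (h : Relation.ReflTransGen (FiresTo G) s t) (hstable : ∀ v, ¬ t.Ready G v) :
    t.dirty = (s.stabilize G).dirty ∧ ∀ v ∈ t.dirty, t.brushes v = (s.stabilize G).brushes v := by
  obtain ⟨h1, h2⟩ := stabilize_spec G s
  have hd : t.dirty = (s.stabilize G).dirty :=
    (firingSequence_subset G h1 h hstable).antisymm (firingSequence_subset G h h1 h2)
  refine ⟨hd, fun v hv => ?_⟩
  have h3 := (firingSequence_invariant G h).2 v hv
  have h4 := (firingSequence_invariant G h1).2 v (hd ▸ hv)
  have h5 : (t.dirtyNbrs G v).card = ((s.stabilize G).dirtyNbrs G v).card := by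
    simp only [dirtyNbrs, hd]
  omega

/-- The total number of brushes that the dirty vertices still lack. -/
def deficit (s : BrushState V) : ℕ :=
  ∑ v ∈ s.dirty, ((s.dirtyNbrs G v).card - s.brushes v)

theorem deficit_le_of_firingSequence {s t : BrushState V}
    (h : Relation.ReflTransGen (FiresTo G) s t) : t.deficit G ≤ s.deficit G := by
  obtain ⟨h1, h2⟩ := firingSequence_invariant G h
  refine (Finset.sum_le_sum fun v hv => ?_).trans (Finset.sum_le_sum_of_subset h1)
  have h3 := h2 v hv
  have h4 : (t.dirtyNbrs G v).card ≤ (s.dirtyNbrs G v).card :=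
    Finset.card_le_card (Finset.filter_subset_filter _ h1)
  omega

theorem deficit_turn_lt {s : BrushState V} (hs : ∀ v, ¬ s.Ready G v) {v : V} (hv : v ∈ s.dirty) :
    (s.turn G v).deficit G < s.deficit G := by
  refine (deficit_le_of_firingSequence G (stabilize_spec G (s.place v)).1).trans_lt ?_
  refine Finset.sum_lt_sum (fun u _ => ?_) ⟨v, hv, ?_⟩
  · have h : s.brushes u ≤ (s.place v).brushes u := by
      by_cases huv : u = v
      · subst huv; simp [place]
      · simp [place, huv]
    exact Nat.sub_le_sub_left h _
  · have h : s.brushes v < (s.dirtyNbrs G v).card := not_le.1 fun h => hs v ⟨hv, h⟩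
    have h' : (s.place v).brushes v = s.brushes v + 1 := by simp [place]
    have h'' : (s.place v).dirtyNbrs G v = s.dirtyNbrs G v := rfl
    rw [h', h'']
    omega

end BrushState

/-- The two players. -/
inductive BrushPlayer
  | Min
  | Max

open BrushState in
/-- `MinForces G k p s`: in the position `s` with player `p` to move, Min can guarantee that the
game is over (all vertices are clean) after at most `k` further turns. The players alternate, and a
turn consists in adding a brush to a dirty vertex. -/
def MinForces {V : Type*} [DecidableEq V] (G : SimpleGraph V) [DecidableRel G.Adj] :
    ℕ → BrushPlayer → BrushState V → Prop
  | 0, _, s => s.dirty = ∅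
  | k + 1, .Min, s => s.dirty = ∅ ∨ ∃ v ∈ s.dirty, MinForces G k .Max (s.turn G v)
  | k + 1, .Max, s => s.dirty = ∅ ∨ ∀ v ∈ s.dirty, MinForces G k .Min (s.turn G v)

/-- The initial position: all vertices are dirty and there are no brushes; vertices without
neighbours are cleaned at once. -/
noncomputable def BrushState.initial {V : Type*} [Fintype V] [DecidableEq V] (G : SimpleGraph V)
    [DecidableRel G.Adj] : BrushState V :=
  BrushState.stabilize G ⟨Finset.univ, fun _ => 0⟩

/-- The game brush number: the length of the game under optimal play when Min starts, that is, the
least number of turns within which Min can force the end of the game. Such a number exists, by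
`exists_minForces_initial`. -/
noncomputable def gameBrushNumber {V : Type*} [Fintype V] [DecidableEq V] (G : SimpleGraph V)
    [DecidableRel G.Adj] : ℕ :=
  sInf {k : ℕ | MinForces G k .Min (BrushState.initial G)}

theorem minForces_of_deficit_le {V : Type*} [DecidableEq V] (G : SimpleGraph V)
    [DecidableRel G.Adj] (k : ℕ) (p : BrushPlayer) (s : BrushState V) (hs : ∀ v, ¬ s.Ready G v)
    (hk : s.deficit G ≤ k) : MinForces G k p s := by
  induction k generalizing p s with
  | zero =>
    by_contra hne
    obtain ⟨v, hv⟩ := Finset.nonempty_iff_ne_empty.2 hne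
    have := BrushState.deficit_turn_lt G hs hv
    omega
  | succ k ih =>
    have key : ∀ q, ∀ v ∈ s.dirty, MinForces G k q (s.turn G v) := fun q v hv =>
      ih q _ (BrushState.stabilize_spec G _).2 (by
        have := BrushState.deficit_turn_lt G hs hv
        omega)
    cases p with
    | Min =>
      rcases s.dirty.eq_empty_or_nonempty with h | ⟨v, hv⟩
      · exact Or.inl h
      · exact Or.inr ⟨v, hv, key _ v hv⟩
    | Max => exact Or.inr (key _)

/-- The game always ends, so that the set in `gameBrushNumber` is nonempty. -/
theorem exists_minForces_initial {V : Type*} [Fintype V] [DecidableEq V] (G : SimpleGraph V)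
    [DecidableRel G.Adj] : ∃ k, MinForces G k .Min (BrushState.initial G) :=
  ⟨_, minForces_of_deficit_le G _ _ _ (BrushState.stabilize_spec G _).2 le_rfl⟩

/-! A position on `K_n` is determined by the list of the vertices that have fired and the number
`c v` of brushes the players have put on each vertex `v`: the vertex that fires after `i` others has
received `i` brushes from them and has `n - 1 - i` dirty neighbours, so it fires once
`c v ≥ n - 1 - 2 * i`. Brushes beyond this threshold are wasted; the first `j` vertices to fire use
`j * (n - j)` brushes.

Lower bound: Max always plays on a vertex with the fewest brushes. This keeps, for every sequence of
`j` vertices, the number of brushes usable on it below the number of brushes outside it plus `g j`,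
for a suitable function `g`. At the end of the game the first `j` vertices that fired carry at
least `j * (n - j)` brushes, all others at least `j * (n - j) - g j`. With `w = 1 - j / n` the total
is about `-2 * w ^ 2 * log w * n ^ 2`, which is largest, namely `n ^ 2 / e`, for `w ^ 2 = 1 / e`.

Upper bound: Min always plays on a dirty vertex with the most brushes. When `m` vertices are dirty
and carry `R` brushes put there by the players, the number of wasted brushes plus
`m ^ 2 * exp (n / m + R / m ^ 2 - 2)` then increases only by a bounded amount per firing, the
essential ingredient being the tangent line bound for `exp`. This potential starts at `n ^ 2 / e`
and always bounds the total number of brushes. -/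

section Strategies

variable {V : Type*} [DecidableEq V] {G : SimpleGraph V} [DecidableRel G.Adj]
  {I J : ℕ → BrushState V → Prop} {N : ℕ}

theorem minForces_of_invariant
    (hmin : ∀ j s, I j s → s.dirty.Nonempty → ∃ v ∈ s.dirty, J (j + 1) (s.turn G v))
    (hmax : ∀ j s, J j s → ∀ v ∈ s.dirty, I (j + 1) (s.turn G v))
    (hI : ∀ j s, I j s → s.dirty.Nonempty → j < N) (hJ : ∀ j s, J j s → s.dirty.Nonempty → j < N)
    {j k : ℕ} (hk : N ≤ j + k) (s : BrushState V) :
    (I j s → MinForces G k .Min s) ∧ (J j s → MinForces G k .Max s) := by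
  induction k generalizing j s with
  | zero =>
    refine ⟨fun h => ?_, fun h => ?_⟩ <;>
      refine Finset.not_nonempty_iff_eq_empty.1 fun hne => ?_
    · exact (hI j s h hne).not_ge hk
    · exact (hJ j s h hne).not_ge hk
  | succ k ih =>
    have ih' := fun v => ih (j := j + 1) (by omega) (s.turn G v)
    refine ⟨fun h => ?_, fun h => Or.inr fun v hv => (ih' v).1 (hmax j s h v hv)⟩
    rcases s.dirty.eq_empty_or_nonempty with he | hne
    · exact Or.inl he
    · obtain ⟨v, hv, hJv⟩ := hmin j s h hne
      exact Or.inr ⟨v, hv, (ih' v).2 hJv⟩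

theorem le_of_minForces_of_invariant
    (hmin : ∀ j s, I j s → ∀ v ∈ s.dirty, J (j + 1) (s.turn G v))
    (hmax : ∀ j s, J j s → s.dirty.Nonempty → ∃ v ∈ s.dirty, I (j + 1) (s.turn G v))
    (hI : ∀ j s, I j s → s.dirty = ∅ → N ≤ j) (hJ : ∀ j s, J j s → s.dirty = ∅ → N ≤ j)
    {j k : ℕ} (s : BrushState V) :
    (I j s → MinForces G k .Min s → N ≤ j + k) ∧ (J j s → MinForces G k .Max s → N ≤ j + k) := by
  induction k generalizing j s with
  | zero => exact ⟨hI j s, hJ j s⟩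
  | succ k ih =>
    have ih' := fun v => ih (j := j + 1) (s.turn G v)
    refine ⟨fun h hf => ?_, fun h hf => ?_⟩
    · rcases hf with he | ⟨v, hv, hf⟩
      · exact le_add_right (hI j s h he)
      · have := (ih' v).2 (hmin j s h v hv) hf
        omega
    · rcases s.dirty.eq_empty_or_nonempty with he | hne
      · exact le_add_right (hJ j s h he)
      · obtain ⟨v, hv, hIv⟩ := hmax j s h hne
        have := (ih' v).1 hIv (hf.resolve_left hne.ne_empty v hv)
        omega

variable [Fintype V]

theorem gameBrushNumber_le_of_invariant
    (hmin : ∀ j s, I j s → s.dirty.Nonempty → ∃ v ∈ s.dirty, J (j + 1) (s.turn G v))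
    (hmax : ∀ j s, J j s → ∀ v ∈ s.dirty, I (j + 1) (s.turn G v))
    (hI : ∀ j s, I j s → s.dirty.Nonempty → j < N) (hJ : ∀ j s, J j s → s.dirty.Nonempty → j < N)
    (hinit : I 0 (BrushState.initial G)) : gameBrushNumber G ≤ N :=
  Nat.sInf_le ((minForces_of_invariant hmin hmax hI hJ (zero_add N).ge _).1 hinit)

theorem le_gameBrushNumber_of_invariant
    (hmin : ∀ j s, I j s → ∀ v ∈ s.dirty, J (j + 1) (s.turn G v))
    (hmax : ∀ j s, J j s → s.dirty.Nonempty → ∃ v ∈ s.dirty, I (j + 1) (s.turn G v))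
    (hI : ∀ j s, I j s → s.dirty = ∅ → N ≤ j) (hJ : ∀ j s, J j s → s.dirty = ∅ → N ≤ j)
    (hinit : I 0 (BrushState.initial G)) : N ≤ gameBrushNumber G :=
  ((le_of_minForces_of_invariant hmin hmax hI hJ _).1 hinit
    (Nat.sInf_mem (exists_minForces_initial G))).trans_eq (zero_add _)

end Strategies

namespace CompleteBrushing

/-- The entry with index `i` is at least `t - 2 * i`. On a complete graph with `n` vertices, the
vertex that fires after `i` others has `n - 1 - i` dirty neighbours and has received `i` brushes
from the vertices fired before it, so the players must have put `n - 1 - 2 * i` brushes on it. -/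
def FiresInOrder : ℤ → List ℕ → Prop
  | _, [] => True
  | t, b :: bs => t ≤ b ∧ FiresInOrder (t - 2) bs

/-- The sum of the entries, the one with index `i` being capped at `t - 2 * i`: the number of
brushes that are not wasted when vertices carrying these numbers of brushes fire in this order. -/
def usable : ℤ → List ℕ → ℤ
  | _, [] => 0
  | t, b :: bs => min (b : ℤ) t + usable (t - 2) bs

theorem firesInOrder_append {t : ℤ} {as bs : List ℕ} :
    FiresInOrder t (as ++ bs) ↔ FiresInOrder t as ∧ FiresInOrder (t - 2 * as.length) bs := by
  induction as generalizing t with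
  | nil => simp [FiresInOrder]
  | cons a as ih =>
    simp only [List.cons_append, FiresInOrder, ih, List.length_cons, Nat.cast_add, Nat.cast_one]
    rw [show t - 2 - 2 * (as.length : ℤ) = t - 2 * (as.length + 1) by ring, and_assoc]

theorem FiresInOrder.lt_of_mem {t : ℤ} {bs : List ℕ} (h : FiresInOrder t bs) {b : ℕ}
    (hb : b ∈ bs) : t - 2 * bs.length < b := by
  obtain ⟨as, bs, rfl⟩ := List.append_of_mem hb
  have := (firesInOrder_append.1 h).2.1
  simp only [List.length_append, List.length_cons]
  omega

theorem usable_le_sum (t : ℤ) (bs : List ℕ) : usable t bs ≤ (bs.sum : ℕ) := by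
  induction bs generalizing t with
  | nil => simp [usable]
  | cons b bs ih =>
    simp only [usable, List.sum_cons, Nat.cast_add]
    exact add_le_add (min_le_left _ _) (ih _)

theorem usable_le (t : ℤ) (bs : List ℕ) : usable t bs ≤ bs.length * (t + 1 - bs.length) := by
  induction bs generalizing t with
  | nil => simp [usable]
  | cons b bs ih =>
    simp only [usable, List.length_cons, Nat.cast_add, Nat.cast_one]
    linarith [ih (t - 2), min_le_right (b : ℤ) t]

theorem FiresInOrder.usable_eq {t : ℤ} {bs : List ℕ} (h : FiresInOrder t bs) :
    usable t bs = bs.length * (t + 1 - bs.length) := by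
  induction bs generalizing t with
  | nil => simp [usable]
  | cons b bs ih =>
    simp only [usable, ih h.2, min_eq_right h.1, List.length_cons, Nat.cast_add, Nat.cast_one]
    ring

theorem FiresInOrder.le_sum {t : ℤ} {bs : List ℕ} (h : FiresInOrder t bs) :
    bs.length * (t + 1 - bs.length) ≤ (bs.sum : ℕ) :=
  h.usable_eq.ge.trans (usable_le_sum t bs)

theorem usable_mono (bs : List ℕ) {t t' : ℤ} (h : t ≤ t') : usable t bs ≤ usable t' bs := by
  induction bs generalizing t t' with
  | nil => rfl
  | cons b bs ih => exact add_le_add (min_le_min_left _ h) (ih (by omega))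

theorem usable_append_cons_le (t : ℤ) (as bs : List ℕ) (b : ℕ) :
    usable t (as ++ b :: bs) ≤ usable t (as ++ bs) + b := by
  induction as generalizing t with
  | nil =>
    simp only [List.nil_append, usable]
    linarith [usable_mono bs (show t - 2 ≤ t by omega), min_le_left (b : ℤ) t]
  | cons a as ih =>
    simp only [List.cons_append, usable]
    linarith [ih (t - 2)]

theorem usable_append_succ_le (t : ℤ) (as bs : List ℕ) (b : ℕ) :
    usable t (as ++ (b + 1) :: bs) ≤ usable t (as ++ b :: bs) + 1 := by
  induction as generalizing t with
  | nil =>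
    simp only [List.nil_append, usable]
    omega
  | cons a as ih =>
    simp only [List.cons_append, usable]
    linarith [ih (t - 2)]

section Outside

variable {V : Type*} [DecidableEq V]

theorem map_update_of_notMem {β : Type*} (c : V → β) {l : List V} {v : V} (hv : v ∉ l) (b : β) :
    l.map (Function.update c v b) = l.map c :=
  List.map_congr_left fun _ hu => Function.update_of_ne (ne_of_mem_of_not_mem hu hv) _ _

theorem map_update_append_cons {β : Type*} (c : V → β) {l₁ l₂ : List V} {v : V}
    (hv : v ∉ l₁ ++ l₂) (b : β) :
    (l₁ ++ v :: l₂).map (Function.update c v b) = l₁.map c ++ b :: l₂.map c := by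
  rw [List.mem_append, not_or] at hv
  rw [List.map_append, List.map_cons, map_update_of_notMem c hv.1, map_update_of_notMem c hv.2,
    Function.update_self]

variable [Fintype V]

/-- The number of brushes outside `l`, when there are `c v` brushes on each vertex `v`. -/
def outside (c : V → ℕ) (l : List V) : ℕ :=
  ∑ v ∈ l.toFinsetᶜ, c v

theorem sum_map_add_outside (c : V → ℕ) {l : List V} (hl : l.Nodup) :
    (l.map c).sum + outside c l = ∑ v, c v := by
  rw [outside, ← List.sum_toFinset c hl, Finset.sum_add_sum_compl]

theorem card_compl_toFinset {l : List V} (hl : l.Nodup) :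
    ((l.toFinsetᶜ.card : ℕ) : ℝ) = Fintype.card V - l.length := by
  rw [Finset.card_compl, List.toFinset_card_of_nodup hl, Nat.cast_sub hl.length_le_card]

theorem outside_le {c : V → ℕ} {l : List V} (hl : l.Nodup) {b : ℝ} (hb : ∀ v ∉ l, (c v : ℝ) ≤ b) :
    (outside c l : ℝ) ≤ (Fintype.card V - l.length) * b := by
  rw [← card_compl_toFinset hl, ← nsmul_eq_mul, outside, Nat.cast_sum]
  exact Finset.sum_le_card_nsmul _ _ _ fun v hv => hb v (by simpa using hv)

theorem le_outside {c : V → ℕ} {l : List V} (hl : l.Nodup) {b : ℝ} (hb : ∀ v ∉ l, b ≤ (c v : ℝ)) :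
    (Fintype.card V - l.length) * b ≤ outside c l := by
  rw [← card_compl_toFinset hl, ← nsmul_eq_mul, outside, Nat.cast_sum]
  exact Finset.card_nsmul_le_sum _ _ _ fun v hv => hb v (by simpa using hv)

theorem outside_append_cons (c : V → ℕ) {l₁ l₂ : List V} {v : V} (hv : v ∉ l₁ ++ l₂) :
    outside c (l₁ ++ l₂) = c v + outside c (l₁ ++ v :: l₂) := by
  have h : (l₁ ++ v :: l₂).toFinsetᶜ = (l₁ ++ l₂).toFinsetᶜ.erase v := by
    ext u
    simp only [Finset.mem_compl, List.mem_toFinset, List.mem_append, List.mem_cons,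
      Finset.mem_erase]
    tauto
  rw [outside, outside, h, Finset.add_sum_erase _ _ (by simpa using hv)]

theorem outside_append (c : V → ℕ) {l l' : List V} (hl : (l ++ l').Nodup) :
    outside c l = (l'.map c).sum + outside c (l ++ l') := by
  have h₁ := sum_map_add_outside c hl
  have h₂ := sum_map_add_outside c hl.of_append_left
  rw [List.map_append, List.sum_append] at h₁
  omega

theorem outside_update_of_mem (c : V → ℕ) {l : List V} {v : V} (hv : v ∈ l) (b : ℕ) :
    outside (Function.update c v b) l = outside c l :=
  Finset.sum_congr rfl fun u hu =>
    Function.update_of_ne (by rintro rfl; simp [hv] at hu) _ _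

theorem outside_update_succ_of_notMem (c : V → ℕ) {l : List V} {v : V} (hv : v ∉ l) :
    outside (Function.update c v (c v + 1)) l = outside c l + 1 := by
  have hv' : v ∈ l.toFinsetᶜ := by simpa using hv
  rw [outside, outside, Finset.sum_update_of_mem hv', ← Finset.add_sum_erase _ c hv',
    Finset.sdiff_singleton_eq_erase]
  ring

theorem sum_update_succ (c : V → ℕ) (v : V) :
    ∑ u, Function.update c v (c v + 1) u = (∑ u, c u) + 1 := by
  simpa [outside] using outside_update_succ_of_notMem c (List.not_mem_nil (a := v))

end Outside

section History

open BrushState SimpleGraph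

variable {V : Type*}

theorem card_dirtyNbrs_completeGraph [DecidableRel (completeGraph V).Adj] {s : BrushState V}
    {v : V} (hv : v ∈ s.dirty) : (s.dirtyNbrs (completeGraph V) v).card + 1 = s.dirty.card := by
  classical
  have : s.dirtyNbrs (completeGraph V) v = s.dirty.erase v := by
    ext u
    simp [dirtyNbrs, completeGraph, and_comm, eq_comm]
  rw [this, Finset.card_erase_add_one hv]

variable [Fintype V]

/-- In the position `s` on the complete graph, the vertices of `l` have fired in this order and the
players have put `c v` brushes on each vertex `v`. -/
structure History (s : BrushState V) (c : V → ℕ) (l : List V) : Prop where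
  nodup : l.Nodup
  mem_dirty : ∀ v, v ∈ s.dirty ↔ v ∉ l
  brushes : ∀ v ∈ s.dirty, s.brushes v = c v + l.length
  firesInOrder : FiresInOrder (Fintype.card V - 1) (l.map c)

/-- A history of a position in which no vertex is ready to fire. -/
structure StableHistory (s : BrushState V) (c : V → ℕ) (l : List V) : Prop
    extends History s c l where
  lt_threshold : ∀ v ∉ l, (c v : ℤ) < Fintype.card V - 1 - 2 * l.length

variable {s : BrushState V} {c : V → ℕ} {l : List V}

theorem History.card_dirty_add_length (h : History s c l) :
    s.dirty.card + l.length = Fintype.card V := by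
  classical
  have : s.dirty = l.toFinsetᶜ := by
    ext v
    simp [h.mem_dirty]
  rw [this, ← List.toFinset_card_of_nodup h.nodup, add_comm, Finset.card_add_card_compl]

theorem History.ready_iff [DecidableRel (completeGraph V).Adj] (h : History s c l) {v : V}
    (hv : v ∈ s.dirty) :
    s.Ready (completeGraph V) v ↔ (Fintype.card V : ℤ) - 1 - 2 * l.length ≤ c v := by
  have h₁ := card_dirtyNbrs_completeGraph hv
  have h₂ := h.card_dirty_add_length
  have h₃ := h.brushes v hv
  simp only [Ready, hv, true_and]
  omega

theorem History.le_sum_map_append {l' : List V} (h : History s c (l ++ l')) :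
    l'.length * (Fintype.card V - 2 * l.length - l'.length) ≤ (((l'.map c).sum : ℕ) : ℝ) := by
  have hf := h.firesInOrder
  rw [List.map_append, firesInOrder_append, List.length_map] at hf
  have hsum := (Int.cast_le (R := ℝ)).2 hf.2.le_sum
  rw [List.length_map, Int.cast_natCast, sub_right_comm _ (1 : ℤ), sub_add_cancel] at hsum
  exact_mod_cast hsum

theorem StableHistory.le_of_forall_dirty_le (h : StableHistory s c l) {v : V} (hv : v ∈ s.dirty)
    (hmin : ∀ u ∈ s.dirty, c v ≤ c u) (u : V) : c v ≤ c u := by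
  by_cases hu : u ∈ s.dirty
  · exact hmin u hu
  · have h₁ := h.firesInOrder.lt_of_mem (List.mem_map_of_mem (by simpa [h.mem_dirty] using hu))
    have h₂ := h.lt_threshold v ((h.mem_dirty v).1 hv)
    rw [List.length_map] at h₁
    omega

theorem StableHistory.le_threshold (h : StableHistory s c l) {v : V} (hv : v ∉ l) :
    (c v : ℝ) ≤ Fintype.card V - 2 - 2 * l.length := by
  have := h.lt_threshold v hv
  have hle : (c v : ℤ) ≤ Fintype.card V - 2 - 2 * l.length := by omega
  exact_mod_cast hle

variable [DecidableEq V]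

theorem History.place (h : History s c l) {v : V} (hv : v ∈ s.dirty) :
    History (s.place v) (Function.update c v (c v + 1)) l where
  nodup := h.nodup
  mem_dirty := h.mem_dirty
  brushes u hu := by
    have hu' := h.brushes u hu
    rcases eq_or_ne u v with rfl | huv
    · simp only [BrushState.place, Function.update_self, hu']
      ring
    · simp only [BrushState.place, Function.update_of_ne huv, hu']
  firesInOrder := by
    rw [map_update_of_notMem c ((h.mem_dirty v).1 hv)]
    exact h.firesInOrder

variable [DecidableRel (completeGraph V).Adj]

theorem History.fire (h : History s c l) {v : V} (hv : s.Ready (completeGraph V) v) :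
    History (s.fire (completeGraph V) v) c (l ++ [v]) where
  nodup := List.nodup_append_comm.1 (List.nodup_cons.2 ⟨(h.mem_dirty v).1 hv.1, h.nodup⟩)
  mem_dirty u := by simp [BrushState.fire, h.mem_dirty, and_comm]
  brushes u hu := by
    obtain ⟨huv, hus⟩ := Finset.mem_erase.1 hu
    have hadj : u ∈ s.dirtyNbrs (completeGraph V) v := by
      simp [dirtyNbrs, hus, completeGraph, huv.symm]
    simp only [BrushState.fire, if_neg huv, if_pos hadj, h.brushes u hus, List.length_append,
      List.length_singleton, add_assoc]
  firesInOrder := by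
    rw [List.map_append, firesInOrder_append, List.length_map]
    exact ⟨h.firesInOrder, (h.ready_iff hv.1).1 hv, trivial⟩

theorem History.of_firingSequence (h : History s c l) {t : BrushState V}
    (hst : Relation.ReflTransGen (FiresTo (completeGraph V)) s t) :
    ∃ l', History t c (l ++ l') := by
  induction hst with
  | refl => exact ⟨[], by simpa using h⟩
  | tail _ hbc ih =>
    obtain ⟨v, hv, rfl⟩ := hbc
    obtain ⟨l', hl'⟩ := ih
    exact ⟨l' ++ [v], by simpa using hl'.fire hv⟩

theorem History.stabilize (h : History s c l) :
    ∃ l', StableHistory (s.stabilize (completeGraph V)) c (l ++ l') := by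
  obtain ⟨hseq, hstable⟩ := stabilize_spec (completeGraph V) s
  obtain ⟨l', hl'⟩ := h.of_firingSequence hseq
  refine ⟨l', hl', fun v hv => ?_⟩
  rw [← not_le, ← hl'.ready_iff ((hl'.mem_dirty v).2 hv)]
  exact hstable v

theorem History.turn (h : History s c l) {v : V} (hv : v ∈ s.dirty) :
    ∃ l', StableHistory (s.turn (completeGraph V) v) (Function.update c v (c v + 1)) (l ++ l') :=
  (h.place hv).stabilize

theorem exists_stableHistory_initial :
    ∃ l, StableHistory (BrushState.initial (completeGraph V)) (fun _ => 0) l :=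
  History.stabilize (l := []) ⟨List.nodup_nil, by simp, by simp, trivial⟩

end History

section LowerBound

theorem usable_map_le {V : Type*} [Fintype V] (c : V → ℕ) (l : List V) :
    (usable (Fintype.card V - 1) (l.map c) : ℝ) ≤ l.length * (Fintype.card V - l.length) := by
  have h := (Int.cast_le (R := ℝ)).2 (usable_le (Fintype.card V - 1) (l.map c))
  rw [List.length_map, sub_add_cancel] at h
  exact_mod_cast h

/-- Max's invariant, up to an error `e`: with `c v` brushes on each vertex `v`, the usable brushes
on any sequence of `j` vertices exceed the brushes outside it by at most `g j`. -/
def Balanced {V : Type*} [Fintype V] [DecidableEq V] (g : ℕ → ℝ) (e : ℝ) (c : V → ℕ) : Prop :=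
  ∀ l : List V, l.Nodup → l.length < Fintype.card V →
    (usable (Fintype.card V - 1) (l.map c) : ℝ) ≤ outside c l + g l.length + e

/-- The conditions on `g` under which Max, on `n` vertices, can maintain `Balanced g 0` by always
playing on a vertex with the fewest brushes. -/
structure Admissible (n : ℕ) (g : ℕ → ℝ) : Prop where
  nonneg : ∀ j < n, 0 ≤ g j
  step : ∀ j, j + 1 < n →
    (n - (j + 1)) * (j + 2 - (g (j + 1) - g j) / 2) ≤ g (j + 1)

variable {V : Type*} [Fintype V] [DecidableEq V] {g : ℕ → ℝ} {e : ℝ} {c : V → ℕ}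

theorem balanced_zero (hg : ∀ j < Fintype.card V, 0 ≤ g j) :
    Balanced g 0 (fun _ : V => 0) := fun l _ hl => by
  have h : usable (Fintype.card V - 1) (l.map fun _ => 0) ≤ 0 := by
    simpa using usable_le_sum (Fintype.card V - 1) (l.map fun _ => 0)
  have h' : (usable (Fintype.card V - 1) (l.map fun _ => 0) : ℝ) ≤ 0 := by exact_mod_cast h
  linarith [hg _ hl, (Nat.cast_nonneg _ : (0 : ℝ) ≤ outside (fun _ => 0) l)]

theorem Balanced.update (hb : Balanced g e c) (v : V) :
    Balanced g (e + 1) (Function.update c v (c v + 1)) := by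
  intro l hl hlen
  have hbl := hb l hl hlen
  by_cases hv : v ∈ l
  · rw [outside_update_of_mem c hv]
    obtain ⟨l₁, l₂, rfl⟩ := List.append_of_mem hv
    rw [map_update_append_cons c (List.nodup_middle.1 hl).notMem]
    rw [List.map_append, List.map_cons] at hbl
    have h : (usable (Fintype.card V - 1) (l₁.map c ++ (c v + 1) :: l₂.map c) : ℝ) ≤
        usable (Fintype.card V - 1) (l₁.map c ++ c v :: l₂.map c) + 1 := by
      exact_mod_cast usable_append_succ_le _ _ _ _
    linarith
  · rw [map_update_of_notMem c hv, outside_update_succ_of_notMem c hv]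
    push_cast
    linarith

theorem Balanced.update_argmin (hg : Admissible (Fintype.card V) g) (hb : Balanced g 1 c) {v : V}
    (hmin : ∀ u, c v ≤ c u) : Balanced g 0 (Function.update c v (c v + 1)) := by
  intro l hl hlen
  by_cases hv : v ∈ l
  swap
  · rw [map_update_of_notMem c hv, outside_update_succ_of_notMem c hv]
    push_cast
    linarith [hb l hl hlen]
  have hcap := usable_map_le (Function.update c v (c v + 1)) l
  have hmany := le_outside hl fun u _ => Nat.cast_le.2 (hmin u)
  rw [outside_update_of_mem c hv]
  obtain ⟨l₁, l₂, rfl⟩ := List.append_of_mem hv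
  obtain ⟨hv', hl'⟩ := List.nodup_cons.1 (List.nodup_middle.1 hl)
  set j := (l₁ ++ l₂).length with hj
  have hlength : (l₁ ++ v :: l₂).length = j + 1 := by simp [hj, add_assoc]
  rw [hlength, Nat.cast_add_one] at hcap hmany
  rw [hlength] at hlen ⊢
  rcases le_or_gt (2 * ((c v : ℝ) + 1)) (g (j + 1) - g j) with hsmall | hlarge
  · -- `v` has few brushes: compare with the sequence without `v`
    have hdrop : (usable (Fintype.card V - 1) (l₁.map c ++ (c v + 1) :: l₂.map c) : ℝ) ≤
        usable (Fintype.card V - 1) ((l₁ ++ l₂).map c) + (c v + 1) := by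
      rw [List.map_append]
      exact_mod_cast usable_append_cons_le _ _ _ _
    have hb' := hb _ hl' (by omega)
    rw [outside_append_cons c hv', ← hj, Nat.cast_add] at hb'
    rw [map_update_append_cons c hv']
    linarith
  · -- every vertex has many brushes: bounding the usable brushes by the caps is enough
    have hj' : (j : ℝ) + 1 ≤ Fintype.card V := by exact_mod_cast hlen.le
    have hprod := mul_nonneg (sub_nonneg.2 hj') (sub_nonneg.2 hlarge.le)
    linarith [hg.step j hlen]

theorem Balanced.le_sum {s : BrushState V} {l : List V} (hb : Balanced g e c) (h : History s c l)
    (hs : s.dirty = ∅) {j : ℕ} (hj : j < Fintype.card V) :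
    2 * (j * (Fintype.card V - j)) - g j - e ≤ ((∑ u, c u : ℕ) : ℝ) := by
  have hl := h.card_dirty_add_length
  rw [hs, Finset.card_empty, zero_add] at hl
  have hlen : (l.take j).length = j := by rw [List.length_take]; omega
  have hnodup : (l.take j).Nodup := h.nodup.sublist (List.take_sublist j l)
  have hfired : FiresInOrder (Fintype.card V - 1) ((l.take j).map c) := by
    have := h.firesInOrder
    rw [← List.take_append_drop j l, List.map_append, firesInOrder_append] at this
    exact this.1
  have husable := hfired.usable_eq
  have hsum := hfired.le_sum
  rw [List.length_map, hlen, sub_add_cancel] at husable hsum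
  have hb' := hb _ hnodup (hlen.trans_lt hj)
  rw [husable, hlen] at hb'
  rw [← sum_map_add_outside c hnodup]
  replace hsum := (Int.cast_le (R := ℝ)).2 hsum
  rw [Int.cast_natCast] at hsum
  push_cast at hb' hsum ⊢
  linarith

theorem Balanced.mono {e' : ℝ} (hb : Balanced g e c) (he : e ≤ e') : Balanced g e' c :=
  fun l hl hlen => (hb l hl hlen).trans (by linarith)

variable [DecidableRel (SimpleGraph.completeGraph V).Adj]

theorem le_gameBrushNumber_completeGraph (hg : Admissible (Fintype.card V) g) {j : ℕ}
    (hj : j < Fintype.card V) :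
    2 * (j * (Fintype.card V - j)) - g j - 1 ≤
      (gameBrushNumber (SimpleGraph.completeGraph V) : ℝ) := by
  rw [← Nat.ceil_le]
  refine le_gameBrushNumber_of_invariant
    (I := fun i s => ∃ c l, StableHistory s c l ∧ ∑ v, c v = i ∧ Balanced g 0 c)
    (J := fun i s => ∃ c l, StableHistory s c l ∧ ∑ v, c v = i ∧ Balanced g 1 c) ?_ ?_ ?_ ?_ ?_
  · rintro i s ⟨c, l, hh, rfl, hb⟩ v hv
    obtain ⟨l', hh'⟩ := hh.toHistory.turn hv
    exact ⟨_, _, hh', sum_update_succ c v, by simpa using hb.update v⟩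
  · rintro i s ⟨c, l, hh, rfl, hb⟩ hs
    obtain ⟨v, hv, hmin⟩ := s.dirty.exists_min_image c hs
    obtain ⟨l', hh'⟩ := hh.toHistory.turn hv
    exact ⟨v, hv, _, _, hh', sum_update_succ c v,
      hb.update_argmin hg (hh.le_of_forall_dirty_le hv hmin)⟩
  · rintro i s ⟨c, l, hh, rfl, hb⟩ hs
    exact Nat.ceil_le.2 ((hb.mono zero_le_one).le_sum hh.toHistory hs hj)
  · rintro i s ⟨c, l, hh, rfl, hb⟩ hs
    exact Nat.ceil_le.2 (hb.le_sum hh.toHistory hs hj)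
  · obtain ⟨l, hl⟩ := exists_stableHistory_initial (V := V)
    exact ⟨_, l, hl, by simp, balanced_zero hg.nonneg⟩

/-- The quotient of `excessBound n m` by `m * (m + 1)`: an integral approximation to the solution
`φ` of the recurrence `φ m - φ (m + 1) = 2 * (n + 1 - m) / ((m + 1) * (m + 2))` to which equality in
`Admissible.step` reduces. -/
noncomputable def excessDensity (n m : ℝ) : ℝ :=
  2 * (n + 2) * (1 / m - 1 / n) + 2 * Real.log (m / n)

/-- The bound in Max's invariant, as a function of the number `m` of vertices outside the sequence;
it is asymptotic to `n ^ 2 * (2 * w - 2 * w ^ 2 + 2 * w ^ 2 * log w)` for `m = w * n`. -/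
noncomputable def excessBound (n m : ℝ) : ℝ :=
  m * (m + 1) * excessDensity n m

theorem excessDensity_nonneg {n m : ℝ} (hm : 0 < m) (hmn : m ≤ n) : 0 ≤ excessDensity n m := by
  have hn : 0 < n := hm.trans_le hmn
  have hlog := Real.one_sub_inv_le_log_of_pos (div_pos hm hn)
  have hinv : (m / n)⁻¹ = 1 + n * (1 / m - 1 / n) := by field_simp; ring
  have hdiff : 0 ≤ 1 / m - 1 / n := sub_nonneg.2 (one_div_le_one_div_of_le hm hmn)
  unfold excessDensity
  linarith

theorem excessDensity_succ_add_le {n m : ℝ} (hm : 0 < m) (hmn : m ≤ n) :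
    excessDensity n (m + 1) + 2 * (n + 1 - m) / ((m + 1) * (m + 2)) ≤ excessDensity n m := by
  have hn : 0 < n := hm.trans_le hmn
  have hlog : Real.log ((m + 1) / n) ≤ Real.log (m / n) + 1 / m := by
    have h := Real.log_le_sub_one_of_pos (show 0 < (m + 1) / m by positivity)
    rw [show (m + 1) / n = m / n * ((m + 1) / m) by field_simp,
      Real.log_mul (by positivity) (by positivity)]
    linarith [show (m + 1) / m - 1 = 1 / m by field_simp; ring]
  have hfrac : 2 * (n + 1 - m) / ((m + 1) * (m + 2)) ≤
      2 * (n + 2) * (1 / m - 1 / (m + 1)) - 2 * (1 / m) := by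
    rw [show 2 * (n + 2) * (1 / m - 1 / (m + 1)) - 2 * (1 / m) =
      2 * (n + 1 - m) / ((m + 1) * m) by field_simp; ring]
    gcongr <;> linarith
  unfold excessDensity
  linarith

theorem admissible_excessBound (n : ℕ) : Admissible n fun j => excessBound n (n - j) where
  nonneg j hj := by
    have hm : (0 : ℝ) < n - j := sub_pos.2 (by exact_mod_cast hj)
    have := excessDensity_nonneg hm (sub_le_self _ j.cast_nonneg)
    unfold excessBound
    positivity
  step j hj := by
    have hm : (0 : ℝ) < n - (j + 1) := sub_pos.2 (by exact_mod_cast hj)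
    have hstep := excessDensity_succ_add_le hm (sub_le_self _ (by positivity))
    set m : ℝ := n - (j + 1) with hmj
    rw [← le_sub_iff_add_le', div_le_iff₀ (by positivity)] at hstep
    simp only [excessBound, Nat.cast_add_one, ← hmj, show (n : ℝ) - j = m + 1 by rw [hmj]; ring]
    have := mul_le_mul_of_nonneg_left hstep hm.le
    rw [show (j : ℝ) = n - m - 1 by rw [hmj]; ring]
    linarith

theorem excessBound_le {n m : ℝ} (hm : 1 ≤ m) (hmn : m ≤ n)
    (hexp : m ≤ n * Real.exp (-(1 / 2))) :
    excessBound n m ≤ 2 * m * (n - m) + 10 * n - m ^ 2 := by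
  have hn : 0 < n := by linarith
  have hlog : Real.log (m / n) ≤ -(1 / 2) := by
    rwa [Real.log_le_iff_le_exp (by positivity), div_le_iff₀' hn]
  have hm1 : m * excessDensity n m ≤ 2 * (n - m) + 4 - m := by
    have h₁ : m * excessDensity n m =
        2 * (n - m) + 4 - 4 * (m / n) + 2 * (m * Real.log (m / n)) := by
      unfold excessDensity
      field_simp
      ring
    have h₂ : m * Real.log (m / n) ≤ m * -(1 / 2) := by gcongr
    have h₃ : 0 ≤ m / n := by positivity
    linarith
  have := mul_le_mul_of_nonneg_left hm1 (show 0 ≤ m + 1 by linarith)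
  unfold excessBound
  linarith

theorem exp_neg_half_sq : Real.exp (-(1 / 2)) ^ 2 = (Real.exp 1)⁻¹ := by
  rw [← Real.exp_nat_mul, ← Real.exp_neg]
  norm_num

theorem sq_div_exp_sub_le_gameBrushNumber_completeGraph (hV : 2 ≤ Fintype.card V) :
    (Fintype.card V : ℝ) ^ 2 / Real.exp 1 - 13 * Fintype.card V ≤
      gameBrushNumber (SimpleGraph.completeGraph V) := by
  set n := Fintype.card V
  have hn2 : (2 : ℝ) ≤ n := by exact_mod_cast hV
  set x : ℝ := n * Real.exp (-(1 / 2)) with hx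
  have hx1 : 1 ≤ x := by
    have := Real.add_one_le_exp (-(1 / 2) : ℝ)
    nlinarith
  have hxn : x ≤ n := mul_le_of_le_one_right n.cast_nonneg (Real.exp_le_one_iff.2 (by norm_num))
  -- the sequences of length `n - ⌊x⌋₊` give the best bound
  set m : ℕ := ⌊x⌋₊
  have hmx : (m : ℝ) ≤ x := Nat.floor_le (by linarith)
  have hxm : x < m + 1 := Nat.lt_floor_add_one x
  have hm1 : 1 ≤ m := Nat.le_floor (by exact_mod_cast hx1)
  have hmn : m ≤ n := by exact_mod_cast hmx.trans hxn
  have hbound := le_gameBrushNumber_completeGraph (V := V) (admissible_excessBound n)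
    (j := n - m) (by omega)
  rw [Nat.cast_sub hmn, sub_sub_cancel] at hbound
  have hexcess := excessBound_le (by exact_mod_cast hm1) (hmx.trans hxn) hmx
  have hsq : (n : ℝ) ^ 2 / Real.exp 1 = x ^ 2 := by
    rw [hx, mul_pow, exp_neg_half_sq, div_eq_mul_inv]
  have hfloor : x ^ 2 ≤ m ^ 2 + 2 * n + 1 := by nlinarith
  linarith

end LowerBound

section UpperBound

/-- If `m` of the `n` vertices are dirty and carry `R` brushes put there by the players, then
`finalBound n m R` bounds the number of brushes not wasted on overfull vertices by the end of the
game, when Min plays well. It is constant along the solutions of `dR/dm = 2 * R / m - (2 * m - n)`,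
which describe the play while all dirty vertices carry about the same number of brushes, and equals
`m ^ 2` when `n * m + R = 2 * m ^ 2`, that is, when these vertices are about to fire. -/
noncomputable def finalBound (n m R : ℝ) : ℝ :=
  m ^ 2 * Real.exp (n / m + R / m ^ 2 - 2)

theorem finalBound_mono (n m : ℝ) : Monotone (finalBound n m) := fun R R' h => by
  unfold finalBound
  gcongr

theorem exp_mul_le_finalBound (n R x : ℝ) {m : ℝ} (hm : m ≠ 0) :
    Real.exp x * (n * m - m ^ 2 + R - m ^ 2 * x) ≤ finalBound n m R := by
  set y := n / m + R / m ^ 2 - 2 with hy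
  have htangent : Real.exp x * (y - x + 1) ≤ Real.exp y := by
    have h := mul_le_mul_of_nonneg_left (Real.add_one_le_exp (y - x)) (Real.exp_pos x).le
    rwa [← Real.exp_add, add_sub_cancel] at h
  have heq : n * m - m ^ 2 + R - m ^ 2 * x = m ^ 2 * (y - x + 1) := by
    rw [hy]
    field_simp
    ring
  rw [heq, mul_left_comm]
  exact mul_le_mul_of_nonneg_left htangent (sq_nonneg m)

theorem le_finalBound (n R : ℝ) {m : ℝ} (hm : m ≠ 0) :
    n * m - m ^ 2 + R ≤ finalBound n m R := by
  simpa using exp_mul_le_finalBound n R 0 hm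

theorem exp_two_lt : Real.exp 2 < 7.5 := by
  have h := Real.exp_one_lt_d9
  have hpos := Real.exp_pos 1
  rw [show (2 : ℝ) = 1 + 1 by norm_num, Real.exp_add]
  nlinarith

theorem finalBound_sub_one_le_of_eq {n m R Y : ℝ} (hm : 2 ≤ m) (hn : 0 ≤ n) (hR : 0 ≤ R)
    (hstable : n * m + R ≤ 2 * m ^ 2) (hY : m * Y = m * (R + (2 * m - n - 1)) - 2 * (R - 1)) :
    finalBound n (m - 1) Y ≤ finalBound n m R + 100 := by
  have hm0 : 0 < m := by linarith
  have hm1 : 0 < m - 1 := by linarith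
  set x := n / (m - 1) + Y / (m - 1) ^ 2 - 2 with hx
  have hxY : x * (m - 1) ^ 2 = n * (m - 1) + Y - 2 * (m - 1) ^ 2 := by
    rw [hx]
    field_simp
  have hx2 : x ≤ 2 := by
    have hYle : n * (m - 1) + Y ≤ 2 * m * (m - 1) := by
      refine le_of_mul_le_mul_left ?_ hm0
      nlinarith
    refine le_of_mul_le_mul_right (a := (m - 1) ^ 2) ?_ (by positivity)
    nlinarith
  have hgap : (m - 1) ^ 2 - (n * m - m ^ 2 + R - m ^ 2 * x) ≤ 13 := by
    refine le_of_mul_le_mul_right (a := (m - 1) ^ 2) ?_ (by positivity)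
    have heq : ((m - 1) ^ 2 - (n * m - m ^ 2 + R - m ^ 2 * x)) * (m - 1) ^ 2 =
        (m - 1) ^ 2 + 3 * m ^ 2 - n * m - R := by
      linear_combination m ^ 2 * hxY + m * hY
    have hnm : 0 ≤ n * m := by positivity
    nlinarith
  have hexp : Real.exp x ≤ Real.exp 2 := Real.exp_le_exp.2 hx2
  calc finalBound n (m - 1) Y
      = Real.exp x * (n * m - m ^ 2 + R - m ^ 2 * x) +
        Real.exp x * ((m - 1) ^ 2 - (n * m - m ^ 2 + R - m ^ 2 * x)) := by
        rw [finalBound]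
        ring
    _ ≤ finalBound n m R + Real.exp x * 13 := by
        gcongr
        exact exp_mul_le_finalBound n R x hm0.ne'
    _ ≤ finalBound n m R + 100 := by linarith [exp_two_lt]

theorem finalBound_sub_one_le {n m R a : ℝ} (hm : 2 ≤ m) (hn : 0 ≤ n) (hR : 0 ≤ R)
    (hstable : n * m + R ≤ 2 * m ^ 2) (ha : R - 1 ≤ m * a) :
    finalBound n (m - 1) (R + (2 * m - n - 1) - 2 * a) ≤ finalBound n m R + 100 := by
  have hm0 : 0 < m := by linarith
  have ha' : (R - 1) / m ≤ a := (div_le_iff₀' hm0).2 ha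
  refine (finalBound_mono n (m - 1) ?_).trans (finalBound_sub_one_le_of_eq hm hn hR hstable
    (Y := R + (2 * m - n - 1) - 2 * ((R - 1) / m)) ?_)
  · linarith
  · field_simp

theorem finalBound_add_le {n m₀ m₁ R D : ℝ} (hm₁ : 0 < m₁) (hm : m₁ ≤ m₀) (hm₀ : m₀ ≤ 3 * m₁)
    (hn : m₁ ≤ n) (hR : 0 ≤ R) (hstable : n * m₁ + R ≤ 2 * m₁ ^ 2) (hD₀ : 0 ≤ D)
    (hD : D ≤ (m₀ - m₁) ^ 2) :
    finalBound n m₁ R + D ≤ finalBound n m₀ (R + (m₀ - m₁) * (m₀ + m₁ - n) + D) := by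
  set e := 2 - n / m₁ - R / m₁ ^ 2 with he
  have heq : m₁ ^ 2 * e = 2 * m₁ ^ 2 - n * m₁ - R := by
    rw [he]
    field_simp
  have he₀ : 0 ≤ e := by
    refine nonneg_of_mul_nonneg_right (a := m₁ ^ 2) ?_ (by positivity)
    linarith
  have he₁ : e ≤ 1 := by
    refine le_of_mul_le_mul_left (a := m₁ ^ 2) ?_ (by positivity)
    nlinarith
  have hexp : D * Real.exp e ≤ D + (m₀ ^ 2 - m₁ ^ 2) * e := by
    have hexp_e : Real.exp e ≤ 1 + 2 * e := by
      have := le_of_abs_le (Real.abs_exp_sub_one_le (by rwa [abs_of_nonneg he₀]))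
      rw [abs_of_nonneg he₀] at this
      linarith
    have h₁ := mul_le_mul_of_nonneg_left hexp_e hD₀
    have h₂ : 2 * D ≤ m₀ ^ 2 - m₁ ^ 2 := by nlinarith
    linarith [mul_le_mul_of_nonneg_right h₂ he₀]
  calc finalBound n m₁ R + D
      = Real.exp (-e) * (m₁ ^ 2 + D * Real.exp e) := by
        rw [finalBound, show n / m₁ + R / m₁ ^ 2 - 2 = -e by rw [he]; ring, mul_add,
          mul_left_comm _ D, ← Real.exp_add, neg_add_cancel, Real.exp_zero]
        ring
    _ ≤ Real.exp (-e) * (m₁ ^ 2 + (D + (m₀ ^ 2 - m₁ ^ 2) * e)) := by gcongr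
    _ = Real.exp (-e) * (n * m₀ - m₀ ^ 2 + (R + (m₀ - m₁) * (m₀ + m₁ - n) + D) -
        m₀ ^ 2 * -e) := by linear_combination (-Real.exp (-e)) * heq
    _ ≤ _ := exp_mul_le_finalBound _ _ _ (by linarith)

variable {V : Type*} [Fintype V] [DecidableEq V] {s : BrushState V} {c : V → ℕ} {l : List V}
  {θ : ℝ}

/-- Min's potential when the vertices of `l` have fired and there are `c v` brushes on each vertex
`v`: the number of wasted brushes plus `finalBound`. When Max is to move, `θ = 1`
counts the brush about to be placed; when Min is to move, `θ = 0`. -/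
noncomputable def potential (θ : ℝ) (c : V → ℕ) (l : List V) : ℝ :=
  (l.map c).sum - l.length * (Fintype.card V - l.length) +
    finalBound (Fintype.card V) (Fintype.card V - l.length) (outside c l + θ)

/-- The value of `potential` after `w` has fired next, where the brushes that `w` still lacks for
firing are added and Max answers each of them by a brush on another vertex. -/
noncomputable def chargedPotential (θ : ℝ) (c : V → ℕ) (l : List V) (w : V) : ℝ :=
  (l.map c).sum - l.length * (Fintype.card V - l.length) +
    finalBound (Fintype.card V) (Fintype.card V - l.length - 1)
      (outside c l + (Fintype.card V - 1 - 2 * l.length) - 2 * c w + θ)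

/-- Min's invariant: the potential is small even after charging the fullest dirty vertex for the
brushes it lacks. -/
def Controlled (θ : ℝ) (c : V → ℕ) (l : List V) : Prop :=
  ∀ w ∉ l, (∀ v ∉ l, c v ≤ c w) →
    chargedPotential θ c l w ≤ (Fintype.card V : ℝ) ^ 2 / Real.exp 1 + 100 * (l.length + 1)

theorem chargedPotential_eq_potential {w : V} (hw : w ∉ l)
    (hcw : (c w : ℝ) = Fintype.card V - 1 - 2 * l.length) :
    chargedPotential θ c l w = potential θ c (l ++ [w]) := by
  have hout : (outside c l : ℝ) = c w + outside c (l ++ [w]) := by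
    have := outside_append_cons c (l₁ := l) (l₂ := []) (by simpa using hw)
    rw [List.append_nil] at this
    exact_mod_cast this
  have harg : (outside c l : ℝ) + (Fintype.card V - 1 - 2 * l.length) - 2 * c w + θ =
      outside c (l ++ [w]) + θ := by linarith
  rw [chargedPotential, harg, potential]
  simp only [List.map_append, List.map_singleton, List.sum_append, List.sum_singleton,
    List.length_append, List.length_singleton, Nat.cast_add, Nat.cast_one, hcw]
  rw [sub_sub]
  ring

theorem chargedPotential_update_self {w : V} (hw : w ∉ l) :
    chargedPotential (θ + 1) (Function.update c w (c w + 1)) l w = chargedPotential θ c l w := by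
  rw [chargedPotential, chargedPotential, map_update_of_notMem c hw,
    outside_update_succ_of_notMem c hw, Function.update_self]
  congr 2
  push_cast
  ring

theorem chargedPotential_update_le {u w w' : V} (hu : u ∉ l)
    (hw : c w ≤ Function.update c u (c u + 1) w') :
    chargedPotential θ (Function.update c u (c u + 1)) l w' ≤ chargedPotential (θ + 1) c l w := by
  rw [chargedPotential, chargedPotential, map_update_of_notMem c hu,
    outside_update_succ_of_notMem c hu]
  have hw' : (c w : ℝ) ≤ Function.update c u (c u + 1) w' := by exact_mod_cast hw
  gcongr
  refine finalBound_mono _ _ ?_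
  push_cast
  linarith

theorem Controlled.update_argmax (h : Controlled θ c l) {w : V} (hw : w ∉ l)
    (hmax : ∀ v ∉ l, c v ≤ c w) : Controlled (θ + 1) (Function.update c w (c w + 1)) l := by
  intro w' hw' hmax'
  obtain rfl : w' = w := by
    by_contra hne
    have h₁ := hmax' w hw
    have h₂ := hmax w' hw'
    rw [Function.update_self, Function.update_of_ne hne] at h₁
    omega
  rw [chargedPotential_update_self hw]
  exact h w' hw hmax

theorem Controlled.update (h : Controlled (θ + 1) c l) {u : V} (hu : u ∉ l) :
    Controlled θ (Function.update c u (c u + 1)) l := by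
  intro w' _ hmax'
  obtain ⟨w, hw, hmax⟩ := l.toFinsetᶜ.exists_max_image c ⟨u, by simpa using hu⟩
  simp only [Finset.mem_compl, List.mem_toFinset] at hw hmax
  refine (chargedPotential_update_le hu (LE.le.trans ?_ (hmax' w hw))).trans (h w hw hmax)
  rcases eq_or_ne w u with rfl | hne
  · simp
  · rw [Function.update_of_ne hne]

theorem StableHistory.finalBound_stable (h : StableHistory s c l) {w : V} (hw : w ∉ l)
    (hθ : θ ≤ 1) :
    Fintype.card V * (Fintype.card V - l.length) + (outside c l + θ) ≤
      2 * ((Fintype.card V : ℝ) - l.length) ^ 2 := by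
  have hout := outside_le h.nodup fun v hv => h.le_threshold hv
  have := h.le_threshold hw
  nlinarith [(c w).cast_nonneg (α := ℝ)]

theorem StableHistory.potential_append_le {l' : List V} (h : StableHistory s c (l ++ l'))
    (hθ₀ : 0 ≤ θ) (hθ₁ : θ ≤ 1) (hle : ∀ v ∈ l', (c v : ℝ) ≤ Fintype.card V - 2 * l.length) {w : V}
    (hw : w ∉ l ++ l') : potential θ c (l ++ l') ≤ potential θ c l := by
  have hstable := h.finalBound_stable hw hθ₁
  have hw' := h.le_threshold hw
  rw [List.length_append, Nat.cast_add] at hstable hw'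
  -- the number of brushes wasted on `l'`
  set D : ℝ := (l'.map c).sum - l'.length * (Fintype.card V - 2 * l.length - l'.length) with hD
  have hD₀ : 0 ≤ D := sub_nonneg.2 h.le_sum_map_append
  have hD₁ : D ≤ (l'.length : ℝ) ^ 2 := by
    have := List.sum_le_card_nsmul (l'.map (Nat.cast ∘ c)) (Fintype.card V - 2 * l.length : ℝ)
      (by simpa using hle)
    rw [List.length_map, nsmul_eq_mul, ← List.map_map, ← Nat.cast_list_sum] at this
    linarith
  have hcascade := finalBound_add_le (m₀ := Fintype.card V - l.length)
    (m₁ := Fintype.card V - (l.length + l'.length)) (by linarith) (by linarith) (by linarith)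
    (by linarith) (by positivity) hstable hD₀ (by linarith)
  have harg : outside c (l ++ l') + θ + ((Fintype.card V - l.length) -
      (Fintype.card V - (l.length + l'.length : ℝ))) * ((Fintype.card V - l.length) +
      (Fintype.card V - (l.length + l'.length : ℝ)) - Fintype.card V) + D = outside c l + θ := by
    rw [outside_append c h.nodup, hD]
    push_cast
    ring
  rw [harg] at hcascade
  simp only [potential, List.map_append, List.sum_append, List.length_append, Nat.cast_add]
  linarith

theorem StableHistory.controlled_of_potential_le {l' : List V} (h : StableHistory s c (l ++ l'))
    (hθ₀ : 0 ≤ θ) (hθ₁ : θ ≤ 1) (hle : ∀ v ∈ l', (c v : ℝ) ≤ Fintype.card V - 2 * l.length)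
    (hpot : potential θ c l ≤ (Fintype.card V : ℝ) ^ 2 / Real.exp 1 + 100 * l.length) :
    Controlled θ c (l ++ l') := by
  intro w hw hmax
  have hmono := h.potential_append_le hθ₀ hθ₁ hle hw
  have hw' := h.le_threshold hw
  have hout := outside_le h.nodup fun v hv => Nat.cast_le (α := ℝ).2 (hmax v hv)
  have hstep := finalBound_sub_one_le (n := Fintype.card V) (a := c w)
    (m := Fintype.card V - (l ++ l').length) (R := outside c (l ++ l') + θ) (by linarith)
    (by positivity) (by positivity) (h.finalBound_stable hw hθ₁) (by linarith)
  have hlen : (l.length : ℝ) ≤ (l ++ l').length := by simp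
  have harg : outside c (l ++ l') + (Fintype.card V - 1 - 2 * ((l ++ l').length : ℝ)) - 2 * c w +
      θ = outside c (l ++ l') + θ + (2 * (Fintype.card V - ((l ++ l').length : ℝ)) -
      Fintype.card V - 1) - 2 * c w := by ring
  rw [potential] at hmono
  rw [chargedPotential, harg]
  linarith

theorem StableHistory.eq_of_fires_next (hs : StableHistory s c l) {u v : V} {l' : List V}
    {s' : BrushState V} (hs' : History s' (Function.update c u (c u + 1)) (l ++ v :: l')) :
    v = u ∧ (c u : ℤ) + 1 = Fintype.card V - 1 - 2 * l.length := by
  have hv : v ∉ l := fun hmem => (List.nodup_middle.1 hs'.nodup).notMem (by simp [hmem])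
  have hlt := hs.lt_threshold v hv
  have hfire := hs'.firesInOrder
  rw [List.map_append, firesInOrder_append, List.map_cons, List.length_map] at hfire
  have hle : (Fintype.card V : ℤ) - 1 - 2 * l.length ≤ Function.update c u (c u + 1) v := hfire.2.1
  rcases eq_or_ne v u with rfl | hne
  · rw [Function.update_self] at hle
    exact ⟨rfl, by omega⟩
  · rw [Function.update_of_ne hne] at hle
    omega

theorem Controlled.append {u : V} {l' : List V} {s' : BrushState V}
    (h : Controlled θ (Function.update c u (c u + 1)) l) (hs : StableHistory s c l)
    (hs' : StableHistory s' (Function.update c u (c u + 1)) (l ++ l')) (hθ₀ : 0 ≤ θ) (hθ₁ : θ ≤ 1) :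
    Controlled θ (Function.update c u (c u + 1)) (l ++ l') := by
  rcases l' with _ | ⟨v, l'⟩
  · simpa using h
  obtain ⟨rfl, hcv⟩ := hs.eq_of_fires_next hs'.toHistory
  have hnodup := List.nodup_cons.1 (List.nodup_middle.1 hs'.nodup)
  obtain ⟨hvl, hvl'⟩ : v ∉ l ∧ v ∉ l' := by simpa [not_or] using hnodup.1
  have hself : Function.update c v (c v + 1) v = c v + 1 := Function.update_self ..
  have hother : ∀ w ≠ v, Function.update c v (c v + 1) w = c w := fun w hw =>
    Function.update_of_ne hw _ _
  have hmax : ∀ w ∉ l, Function.update c v (c v + 1) w ≤ Function.update c v (c v + 1) v := by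
    intro w hw
    rcases eq_or_ne w v with rfl | hne
    · rfl
    · have := hs.lt_threshold w hw
      rw [hself, hother w hne]
      omega
  have hpot := h v hvl hmax
  rw [chargedPotential_eq_potential hvl (by rw [hself]; exact_mod_cast hcv)] at hpot
  rw [List.append_cons] at hs' ⊢
  refine hs'.controlled_of_potential_le hθ₀ hθ₁ (fun w hw => ?_) (by simpa using hpot)
  rw [hother w (ne_of_mem_of_not_mem hw hvl')]
  refine (hs.le_threshold fun hwl => hnodup.2.disjoint hwl hw).trans_eq ?_
  push_cast [List.length_append, List.length_singleton]
  ring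

theorem Controlled.sum_le (h : Controlled θ c l) (hs : StableHistory s c l) (hθ : 0 ≤ θ)
    (hne : s.dirty.Nonempty) :
    ((∑ v, c v : ℕ) : ℝ) ≤
      (Fintype.card V : ℝ) ^ 2 / Real.exp 1 + 100 * Fintype.card V := by
  obtain ⟨w, hw, hmax⟩ := s.dirty.exists_max_image c hne
  simp only [hs.mem_dirty] at hw hmax
  have hcharged := h w hw hmax
  rw [chargedPotential] at hcharged
  have hthreshold := hs.le_threshold hw
  have hfinal := le_finalBound (Fintype.card V)
    (outside c l + (Fintype.card V - 1 - 2 * l.length) - 2 * c w + θ)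
    (show (Fintype.card V : ℝ) - l.length - 1 ≠ 0 by linarith)
  rw [← sum_map_add_outside c hs.nodup, Nat.cast_add]
  linarith

theorem controlled_initial {l : List V} (h : StableHistory s (fun _ => 0) l) :
    Controlled 0 (fun _ => 0) l := by
  refine h.controlled_of_potential_le (l := []) le_rfl zero_le_one (by simp) ?_
  rcases eq_or_ne (Fintype.card V : ℝ) 0 with hn | hn
  · simp [potential, finalBound, hn]
  · have hexp : (1 : ℝ) - 2 = -1 := by norm_num
    simp [potential, finalBound, outside, hn, hexp, Real.exp_neg, div_eq_mul_inv]

variable [DecidableRel (SimpleGraph.completeGraph V).Adj]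

theorem gameBrushNumber_completeGraph_le :
    (gameBrushNumber (SimpleGraph.completeGraph V) : ℝ) ≤
      (Fintype.card V : ℝ) ^ 2 / Real.exp 1 + 100 * Fintype.card V + 1 := by
  set B : ℝ := (Fintype.card V : ℝ) ^ 2 / Real.exp 1 + 100 * Fintype.card V
  let position (θ : ℝ) (j : ℕ) (s : BrushState V) : Prop :=
    ∃ c l, StableHistory s c l ∧ ∑ v, c v = j ∧ Controlled θ c l
  have lt_of_dirty {θ : ℝ} (hθ : 0 ≤ θ) (j : ℕ) (s : BrushState V) (h : position θ j s)
      (hne : s.dirty.Nonempty) : j < ⌊B⌋₊ + 1 := by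
    obtain ⟨c, l, hs, rfl, hc⟩ := h
    exact Nat.lt_succ_of_le (Nat.le_floor (hc.sum_le hs hθ hne))
  have hle : gameBrushNumber (SimpleGraph.completeGraph V) ≤ ⌊B⌋₊ + 1 := by
    refine gameBrushNumber_le_of_invariant (I := position 0) (J := position 1) ?_ ?_
      (lt_of_dirty le_rfl) (lt_of_dirty zero_le_one) ?_
    · rintro _ s ⟨c, l, hs, rfl, hc⟩ hne
      obtain ⟨w, hw, hmax⟩ := s.dirty.exists_max_image c hne
      obtain ⟨l', hs'⟩ := hs.toHistory.turn hw
      simp only [hs.mem_dirty] at hmax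
      have hwl := (hs.mem_dirty w).1 hw
      refine ⟨w, hw, _, _, hs', sum_update_succ c w, ?_⟩
      refine Controlled.append ?_ hs hs' zero_le_one le_rfl
      simpa using hc.update_argmax hwl hmax
    · rintro _ s ⟨c, l, hs, rfl, hc⟩ u hu
      obtain ⟨l', hs'⟩ := hs.toHistory.turn hu
      have hul := (hs.mem_dirty u).1 hu
      refine ⟨_, _, hs', sum_update_succ c u, ?_⟩
      exact Controlled.append (Controlled.update (by simpa using hc) hul) hs hs' le_rfl zero_le_one
    · obtain ⟨l, hs⟩ := exists_stableHistory_initial (V := V)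
      exact ⟨_, l, hs, by simp, controlled_initial hs⟩
  calc (gameBrushNumber (SimpleGraph.completeGraph V) : ℝ) ≤ (⌊B⌋₊ + 1 : ℕ) := by
        exact_mod_cast hle
    _ ≤ B + 1 := by
        push_cast
        gcongr
        exact Nat.floor_le (by positivity)

end UpperBound

theorem isBigO_gameBrushNumber_completeGraph_sub :
    (fun n : ℕ => (gameBrushNumber (SimpleGraph.completeGraph (Fin n)) : ℝ) -
      (n : ℝ) ^ 2 / Real.exp 1) =O[atTop] fun n : ℕ => (n : ℝ) := by
  refine IsBigO.of_bound 101 ?_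
  filter_upwards [eventually_ge_atTop 2] with n hn
  have hlower := sq_div_exp_sub_le_gameBrushNumber_completeGraph (V := Fin n) (by simpa using hn)
  have hupper := gameBrushNumber_completeGraph_le (V := Fin n)
  rw [Fintype.card_fin] at hlower hupper
  have hn' : (2 : ℝ) ≤ n := by exact_mod_cast hn
  rw [Real.norm_eq_abs, Real.norm_natCast, abs_le]
  constructor <;> linarith

theorem isLittleO_natCast_sq_div_exp :
    (fun n : ℕ => (n : ℝ)) =o[atTop] fun n : ℕ => (n : ℝ) ^ 2 / Real.exp 1 := by
  have h : (fun n : ℕ => (n : ℝ)) =o[atTop] fun n : ℕ => (n : ℝ) ^ 2 := by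
    simpa [Function.comp_def] using (isLittleO_pow_pow_atTop_of_lt (𝕜 := ℝ)
      (show 1 < 2 by norm_num)).comp_tendsto (tendsto_natCast_atTop_atTop (R := ℝ))
  simpa [div_eq_inv_mul] using h.const_mul_right (inv_ne_zero (Real.exp_ne_zero 1))

end CompleteBrushing

theorem mainTheorem2 :
    (fun n : ℕ => (gameBrushNumber (SimpleGraph.completeGraph (Fin n)) : ℝ))
      ~[atTop] (fun n : ℕ => (n : ℝ) ^ 2 / Real.exp 1) :=
  CompleteBrushing.isBigO_gameBrushNumber_completeGraph_sub.trans_isLittleO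
    CompleteBrushing.isLittleO_natCast_sq_div_exp
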